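/- Let $A$ be a Polish space. Write $\mathcal M_1(S)$ for the set of Borel probability measures on a Polish space $S$, with the topology of weak convergence. For $n\ge 1$, a word $\mathbf w=(w_1,\dots,w_n)\in A^n$ of length $|\mathbf w|=n$ and $1\le k\le n$ put $$\mathrm{RSS}(\mathbf w,k)=\binom nk^{-1}\sum_{1\le j_1<\dots<j_k\le n}\delta_{(w_{j_1},\dots,w_{j_k})}\in\mathcal M_1(A^k),\qquad \rho_{\mathbf w}=\frac1n\sum_{j=1}^n\delta_{(w_j,\,j/n)}\in\mathcal M_1(A\times\mathbb R).$$ For $\mu\in\mathcal M_1(A^n)$ put $\mathrm{PS}(\mu)=\int_{A^n}\rho_{\mathbf v}\,d\mu(\mathbf v)\in\mathcal M_1(A\times\mathbb R)$. For $\rho\in\mathcal M_1(A\times\mathbb R)$ and $k\ge1$ let $\mathrm{SPREAD}(\rho,k)\in\mathcal M_1(A^k)$ be the law of $(Y_{\pi(1)},\dots,Y_{\pi(k)})$, where $(Y_1,X_1),\dots,(Y_k,X_k)$ are i.i.d. with law $\rho$ and $\pi$ is the permutation that sorts $X_1,\dots,X_k$ increasingly (ties being resolved by the order of the indices). Let $$\mathcal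 C(A)=\{\rho\in\mathcal M_1(A\times\mathbb R):\ \rho(A\times[0,t])=t\ \text{for all }t\in[0,1]\},$$ a subspace of $\mathcal M_1(A\times\mathbb R)$. A sequence $(\mathbf w_n)_{n\ge1}$ of words over $A$ is RSS-convergent with limit $\boldsymbol\mu=(\mu_k)_{k\ge1}\in\prod_{k\ge1}\mathcal M_1(A^k)$ if $|\mathbf w_n|\to\infty$ and, for each $k\ge1$, $\mathrm{RSS}(\mathbf w_n,k)\to\mu_k$ weakly as $n\to\infty$. The Martin boundary $\partial_{\mathrm{RSS}}A$ is the set of all limits of RSS-convergent sequences, a topological subspace of the product space $\prod_{k\ge1}\mathcal M_1(A^k)$. Theorem. Let $(\mathbf w_n)_{n\ge1}$ be a sequence of (non-empty) words over $A$ with $|\mathbf w_n|\to\infty$. The following are equivalent: (i) $(\mathbf w_n)$ is RSS-convergent towards some limit $\boldsymbol\mu=(\mu_k)_{k\ge1}\in\partial_{\mathrm{RSS}}A$; (ii) $(\rho_{\mathbf w_n})$ converges weakly in $\mathcal M_1(A\times\mathbb R)$ towards some $\rho\in\mathcal C(A)$. If (i) and (ii) hold, then $$\rho=\lim_{k\to\infty}\mathrm{PS}(\mu_k)\qquad\text{and}\qquad\mu_k=\mathrm{SPREAD}(\rho,k)\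 \text{ for each }k\ge1.$$ Moreover this correspondence is a homeomorphism between $\mathcal C(A)$ and $\partial_{\mathrm{RSS}}A$: the map $\rho\mapsto(\mathrm{SPREAD}(\rho,k))_{k\ge1}$ is a homeomorphism of $\mathcal C(A)$ onto $\partial_{\mathrm{RSS}}A$, with inverse $\boldsymbol\mu\mapsto\lim_{k\to\infty}\mathrm{PS}(\mu_k)$ (weak limit). -/

import Mathlib

open MeasureTheory Filter Topology

namespace ErasedWord

/-- Non-empty finite words over `A`, that is, the disjoint union of the spaces `A ^ n`, `n ≥ 1`.
The letters of a word of length `n` are indexed by `Fin n = {0, …, n - 1}`. -/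
abbrev Word (A : Type*) := Σ n : ℕ+, (Fin n → A)

/-- The length of a word. -/
def Word.length {A : Type*} (w : Word A) : ℕ := w.1

/-- Increasing index tuples `j_1 < … < j_k` in `Fin n` form a finite set. -/
noncomputable instance fintypeOrderEmbFin (k n : ℕ) : Fintype (Fin k ↪o Fin n) :=
  Fintype.ofInjective (fun e : Fin k ↪o Fin n => (e : Fin k → Fin n)) DFunLike.coe_injective

theorem card_orderEmbFin (k n : ℕ) : Fintype.card (Fin k ↪o Fin n) = n.choose k := by
  rw [← Nat.card_eq_fintype_card, Nat.card_congr (Set.powersetCard.ofFinEmbEquiv),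
    Set.powersetCard.card, Nat.card_eq_fintype_card, Fintype.card_fin]

section Measurable

variable {A : Type*} [MeasurableSpace A]

/-- The law of a uniformly chosen subsequence of length `k` of the word `v` of length `n`, as a
measure:
`(n choose k)⁻¹ ∑_{j_1 < … < j_k} δ_{(v_{j_1}, …, v_{j_k})}`. It is used for `k ≤ n` only. -/
noncomputable def rssMeasure {n : ℕ} (v : Fin n → A) (k : ℕ) : Measure (Fin k → A) :=
  ((n.choose k : ENNReal))⁻¹ • ∑ j : Fin k ↪o Fin n, Measure.dirac (fun i => v (j i))

theorem isProbabilityMeasure_rssMeasure {n : ℕ} (v : Fin n → A) {k : ℕ} (h : k ≤ n) :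
    IsProbabilityMeasure (rssMeasure v k) := by
  constructor
  have h0 : (n.choose k : ENNReal) ≠ 0 := by
    exact_mod_cast (Nat.choose_pos h).ne'
  simp [rssMeasure, card_orderEmbFin, ENNReal.inv_mul_cancel h0 (ENNReal.natCast_ne_top _)]

/-- `RSS(w, k)`: the law of a uniformly chosen subsequence of length `k` of the word `w`. It is
meaningful for `k ≤ |w|`; for the remaining `k` (finitely many indices of a sequence of words with
lengths tending to infinity) the value is an arbitrary Dirac measure. -/
noncomputable def rss (w : Word A) (k : ℕ+) : ProbabilityMeasure (Fin k → A) :=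
  ⟨if (k : ℕ) ≤ w.length then rssMeasure w.2 k
    else Measure.dirac (fun _ => w.2 ⟨0, w.1.pos⟩), by
    split_ifs with h
    · exact isProbabilityMeasure_rssMeasure w.2 h
    · infer_instance⟩

/-- The empirical position measure of `v = (v_1, …, v_n)`, as a measure:
`n⁻¹ ∑_{j = 1}^n δ_{(v_j, j / n)}`. -/
noncomputable def positionMeasure {n : ℕ} (v : Fin n → A) : Measure (A × ℝ) :=
  (n : ENNReal)⁻¹ • ∑ j : Fin n, Measure.dirac (v j, ((j : ℕ) + 1 : ℝ) / n)

theorem isProbabilityMeasure_positionMeasure {n : ℕ+} (v : Fin n → A) :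
    IsProbabilityMeasure (positionMeasure v) := by
  constructor
  have h0 : ((n : ℕ) : ENNReal) ≠ 0 := by exact_mod_cast n.ne_zero
  simp [positionMeasure, ENNReal.inv_mul_cancel h0 (ENNReal.natCast_ne_top _)]

theorem measurable_positionMeasure (n : ℕ) :
    Measurable (positionMeasure : (Fin n → A) → Measure (A × ℝ)) := by
  refine Measure.measurable_of_measurable_coe _ fun s hs => ?_
  have : ∀ j : Fin n, Measurable fun v : Fin n → A =>
      Measure.dirac (v j, ((j : ℕ) + 1 : ℝ) / n) s := fun j =>
    (Measure.measurable_coe hs).comp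
      (Measure.measurable_dirac.comp ((measurable_pi_apply j).prodMk measurable_const))
  simp only [positionMeasure, Measure.smul_apply, Measure.finsetSum_apply, smul_eq_mul]
  exact (Finset.measurable_sum _ fun j _ => this j).const_mul _

/-- The empirical position measure `ρ_w` of a word `w`. -/
noncomputable def rho (w : Word A) : ProbabilityMeasure (A × ℝ) :=
  ⟨positionMeasure w.2, isProbabilityMeasure_positionMeasure w.2⟩

/-- The position sample `PS(μ) = ∫ ρ_v dμ(v)` of a law `μ` on words of length `n`. -/
noncomputable def positionSample {n : ℕ+} (μ : ProbabilityMeasure (Fin n → A)) :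
    ProbabilityMeasure (A × ℝ) :=
  ⟨(μ : Measure (Fin n → A)).bind positionMeasure,
    isProbabilityMeasure_bind (measurable_positionMeasure n).aemeasurable
      (ae_of_all _ fun v => isProbabilityMeasure_positionMeasure v)⟩

/-- Induced order statistics: the letters of the pairs `(y_i, x_i)`, listed in the order of
increasing `x_i`; ties are resolved by the original order (`Tuple.sort` is a stable sort). -/
noncomputable def inducedOrderStat {n : ℕ} (z : Fin n → A × ℝ) : Fin n → A :=
  fun i => (z (Tuple.sort (fun l => (z l).2) i)).1

theorem measurable_sort (n : ℕ) :
    Measurable[_, ⊤] (Tuple.sort : (Fin n → ℝ) → Equiv.Perm (Fin n)) := by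
  let _ : MeasurableSpace (Equiv.Perm (Fin n)) := ⊤
  refine measurable_to_countable' fun σ => ?_
  have : (Tuple.sort : (Fin n → ℝ) → Equiv.Perm (Fin n)) ⁻¹' {σ} =
      {x | ∀ i j, (i ≤ j → x (σ i) ≤ x (σ j)) ∧ (i < j → x (σ i) = x (σ j) → σ i < σ j)} := by
    ext x
    simp only [Set.mem_preimage, Set.mem_singleton_iff, Set.mem_ofPred_eq]
    rw [eq_comm, Tuple.eq_sort_iff]
    exact ⟨fun h i j => ⟨fun hij => h.1 hij, h.2 i j⟩,
      fun h => ⟨fun i j hij => (h i j).1 hij, fun i j => (h i j).2⟩⟩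
  rw [this]
  have e : ∀ i, Measurable fun x : Fin n → ℝ => x (σ i) := fun i => measurable_pi_apply _
  refine measurableSet_setOfPred.2 ?_
  refine Measurable.forall fun i => Measurable.forall fun j => ?_
  refine Measurable.and (measurable_const.imp ?_) (measurable_const.imp (Measurable.imp ?_ ?_))
  · exact measurableSet_setOfPred.1 (measurableSet_le (e i) (e j))
  · exact measurableSet_setOfPred.1 (measurableSet_eq_fun (e i) (e j))
  · exact measurable_const

theorem measurable_inducedOrderStat (n : ℕ) :
    Measurable (inducedOrderStat : (Fin n → A × ℝ) → Fin n → A) := by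
  let _ : MeasurableSpace (Equiv.Perm (Fin n)) := ⊤
  have h1 : Measurable fun p : (Fin n → A × ℝ) × Equiv.Perm (Fin n) =>
      fun i => (p.1 (p.2 i)).1 :=
    measurable_from_prod_countable_left fun σ =>
      measurable_pi_lambda _ fun i => (measurable_pi_apply (σ i)).fst
  have h2 : Measurable fun z : Fin n → A × ℝ => Tuple.sort (fun l => (z l).2) :=
    (measurable_sort n).comp (measurable_pi_lambda _ fun i => (measurable_pi_apply i).snd)
  exact h1.comp (measurable_id.prodMk h2)

/-- `SPREAD(ρ, n)`: the law of the induced order statistics of `n` independent pairs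
`(Y_1, X_1), …, (Y_n, X_n)` with law `ρ`. -/
noncomputable def spread (ρ : ProbabilityMeasure (A × ℝ)) (n : ℕ+) :
    ProbabilityMeasure (Fin n → A) :=
  (ProbabilityMeasure.pi fun _ : Fin n => ρ).map
    (measurable_inducedOrderStat (n : ℕ)).aemeasurable

/-- `C(A)`: the probability measures `ρ` on `A × ℝ` with `ρ (A × [0, t]) = t` for all
`t ∈ [0, 1]`. -/
def uniformSecondMarginal (A : Type*) [MeasurableSpace A] : Set (ProbabilityMeasure (A × ℝ)) :=
  {ρ | ∀ t ∈ Set.Icc (0 : ℝ) 1,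
    (ρ : Measure (A × ℝ)) (Set.univ ×ˢ Set.Icc (0 : ℝ) t) = ENNReal.ofReal t}

end Measurable

section Topological

variable {A : Type*} [TopologicalSpace A] [PolishSpace A] [MeasurableSpace A] [BorelSpace A]

/-- The sequence of words `w` is RSS-convergent with limit `μ = (μ_k)_{k ≥ 1}`: the lengths tend
to infinity and `RSS(w_n, k)` converges weakly to `μ_k` for each `k ≥ 1`. -/
def RSSConvergesTo (w : ℕ → Word A) (μ : (k : ℕ+) → ProbabilityMeasure (Fin k → A)) : Prop :=
  Tendsto (fun n => (w n).length) atTop atTop ∧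
    ∀ k : ℕ+, Tendsto (fun n => rss (w n) k) atTop (𝓝 (μ k))

/-- The Martin boundary of the space of words with respect to RSS: the set of limits of
RSS-convergent sequences, inside the product of the spaces of probability measures on `A ^ k`,
`k ≥ 1` (weak topology on each factor, product topology, subspace topology). -/
def martinBoundary (A : Type*) [TopologicalSpace A] [PolishSpace A] [MeasurableSpace A]
    [BorelSpace A] : Set ((k : ℕ+) → ProbabilityMeasure (Fin k → A)) :=
  {μ | ∃ w : ℕ → Word A, RSSConvergesTo w μ}

end Topological

end ErasedWord

namespace ErasedWord

open ProbabilityTheory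

section Empirical

variable {Ω : Type*} [MeasurableSpace Ω]

/-- The empirical measure of a tuple of points. -/
noncomputable def empirical {n : ℕ+} (z : Fin n → Ω) : ProbabilityMeasure Ω :=
  ⟨((n : ℕ) : ENNReal)⁻¹ • ∑ j : Fin n, Measure.dirac (z j), by
    constructor
    have h0 : ((n : ℕ) : ENNReal) ≠ 0 := by exact_mod_cast n.ne_zero
    simp [ENNReal.inv_mul_cancel h0 (ENNReal.natCast_ne_top _)]⟩

theorem integral_empirical {n : ℕ+} (z : Fin n → Ω) {f : Ω → ℝ} (hf : StronglyMeasurable f) :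
    ∫ x, f x ∂(empirical z : Measure Ω) = ((n : ℕ) : ℝ)⁻¹ * ∑ j, f (z j) := by
  change ∫ x, f x ∂(((n : ℕ) : ENNReal)⁻¹ • ∑ j : Fin n, Measure.dirac (z j)) = _
  rw [integral_smul_measure, integral_finsetSum_measure]
  · simp only [integral_dirac' f _ hf]
    simp
  · intro i _
    exact (integrable_dirac' hf (by simp))

theorem empirical_apply {n : ℕ+} (z : Fin n → Ω) {s : Set Ω} (hs : MeasurableSet s)
    [DecidablePred (· ∈ s)] :
    (empirical z : Measure Ω) s =
      ((n : ℕ) : ENNReal)⁻¹ * (Finset.univ.filter fun j => z j ∈ s).card := by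
  change (((n : ℕ) : ENNReal)⁻¹ • ∑ j : Fin n, Measure.dirac (z j)) s = _
  simp only [Measure.smul_apply, Measure.finsetSum_apply, Measure.dirac_apply' _ hs,
    Set.indicator_apply, Pi.one_apply, Finset.sum_boole, smul_eq_mul]

/-- A weak law of large numbers with a rate, uniform in the sampling distribution. -/
theorem integral_abs_sampleMean_sub_le (ρ : Measure Ω) [IsProbabilityMeasure ρ] (n : ℕ+)
    {h : Ω → ℝ} (hm : Measurable h) {b : ℝ} (hb : ∀ x, |h x| ≤ b) :
    ∫ z, |((n : ℕ) : ℝ)⁻¹ * ∑ i, h (z i) - ∫ x, h x ∂ρ| ∂(Measure.pi fun _ : Fin n => ρ) ≤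
      b / √(n : ℕ) := by
  have hn : (0 : ℝ) < (n : ℕ) := by exact_mod_cast n.pos
  obtain ⟨x₀⟩ : Nonempty Ω := nonempty_of_isProbabilityMeasure ρ
  have hb0 : 0 ≤ b := (abs_nonneg _).trans (hb x₀)
  set P := Measure.pi fun _ : Fin n => ρ
  set S : (Fin n → Ω) → ℝ := fun z => ∑ i, h (z i)
  set m := ∫ x, h x ∂ρ
  have hmemh : MemLp h 2 ρ := MemLp.of_bound hm.aestronglyMeasurable b (ae_of_all _ fun x => hb x)
  have hSm : Measurable S := Finset.measurable_sum _ fun i _ => hm.comp (measurable_pi_apply i)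
  have hSb : ∀ z, |S z| ≤ n * b := fun z => by
    refine (Finset.abs_sum_le_sum_abs _ _).trans ((Finset.sum_le_sum fun i _ => hb (z i)).trans ?_)
    simp
  have hvarS : Var[S; P] ≤ n * b ^ 2 := by
    have : S = ∑ i, fun z : Fin n → Ω => h (z i) := by ext z; simp [S]
    rw [this, variance_sum_pi (X := fun _ : Fin n => h) fun _ => hmemh]
    refine (Finset.sum_le_sum fun i _ => variance_le_sq_of_bounded (a := -b) (b := b)
      (ae_of_all _ fun x => abs_le.1 (hb x)) hm.aemeasurable).trans ?_
    simp only [sub_neg_eq_add, Finset.sum_const, Finset.card_univ, Fintype.card_fin, nsmul_eq_mul]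
    ring_nf
    rfl
  have hmean : ∫ z, S z ∂P = n * m := by
    simp only [S]
    rw [integral_finsetSum]
    · simp [P, m, integral_comp_eval (μ := fun _ : Fin n => ρ) hm.aestronglyMeasurable]
    · intro i _
      exact Integrable.of_bound (hm.comp (measurable_pi_apply i)).aestronglyMeasurable b
        (ae_of_all _ fun z => hb (z i))
  have hmemS : MemLp S 2 P := MemLp.of_bound hSm.aestronglyMeasurable (n * b) (ae_of_all _ hSb)
  set Y : (Fin n → Ω) → ℝ := fun z => |S z - n * m|
  have hmemY : MemLp Y 2 P := (hmemS.sub (memLp_const _)).norm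
  have hY2 : ∫ z, (Y ^ 2) z ∂P = Var[S; P] := by
    rw [variance_eq_integral hSm.aemeasurable, hmean]
    simp [Y, sq_abs]
  have hY : (∫ z, Y z ∂P) ^ 2 ≤ n * b ^ 2 := by
    have := variance_nonneg Y P
    rw [variance_eq_sub hmemY, hY2] at this
    linarith
  have hYb : ∫ z, Y z ∂P ≤ √(n : ℕ) * b := by
    refine (abs_le_of_sq_le_sq' ?_ (by positivity)).2
    rwa [mul_pow, Real.sq_sqrt hn.le]
  have heq : ∀ z : Fin n → Ω, |((n : ℕ) : ℝ)⁻¹ * ∑ i, h (z i) - m| = ((n : ℕ) : ℝ)⁻¹ * Y z := by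
    intro z
    simp only [Y, S]
    rw [← abs_of_pos (inv_pos.2 hn), ← abs_mul, abs_of_pos (inv_pos.2 hn), mul_sub,
      inv_mul_cancel_left₀ hn.ne']
  simp only [heq]
  rw [integral_const_mul, div_eq_mul_inv]
  refine (mul_le_mul_of_nonneg_left hYb (by positivity)).trans (le_of_eq ?_)
  have h1 : √((n : ℕ) : ℝ) ≠ 0 := (Real.sqrt_pos.2 hn).ne'
  have h2 : ((n : ℕ) : ℝ) = √(n : ℕ) * √(n : ℕ) := (Real.mul_self_sqrt hn.le).symm
  rw [inv_mul_eq_div, div_eq_iff hn.ne']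
  nth_rewrite 3 [h2]
  field_simp

end Empirical

section Marginal

variable {A : Type*} [MeasurableSpace A]

theorem snd_eq_volume_restrict {ρ : ProbabilityMeasure (A × ℝ)}
    (hρ : ρ ∈ uniformSecondMarginal A) :
    (ρ : Measure (A × ℝ)).map Prod.snd = volume.restrict (Set.Icc (0 : ℝ) 1) := by
  have hone : (ρ : Measure (A × ℝ)) (Set.univ ×ˢ Set.Icc (0 : ℝ) 1) = 1 := by
    simpa using hρ 1 (by simp)
  have hae : ∀ᵐ x ∂(ρ : Measure (A × ℝ)).map Prod.snd, x ∈ Set.Icc (0 : ℝ) 1 := by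
    refine (ae_map_iff measurable_snd.aemeasurable (p := (· ∈ Set.Icc (0 : ℝ) 1)) measurableSet_Icc).2 ?_
    rw [← prob_compl_eq_zero_iff (MeasurableSet.univ.prod measurableSet_Icc)] at hone
    rw [ae_iff]
    convert hone using 2
    ext p; simp
  have : IsProbabilityMeasure ((ρ : Measure (A × ℝ)).map Prod.snd) :=
    Measure.isProbabilityMeasure_map measurable_snd.aemeasurable
  have hrestr : ∀ s, ((ρ : Measure (A × ℝ)).map Prod.snd) s =
      ((ρ : Measure (A × ℝ)).map Prod.snd) (s ∩ Set.Icc 0 1) := fun s => by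
    refine measure_congr ?_
    filter_upwards [hae] with x hx
    simp only [eq_iff_iff]
    exact ⟨fun h => ⟨h, hx⟩, fun h => h.1⟩
  refine Measure.ext_of_Iic _ _ fun a => ?_
  rw [hrestr, Measure.restrict_apply measurableSet_Iic]
  rw [Measure.map_apply measurable_snd (measurableSet_Iic.inter measurableSet_Icc)]
  have hset : Set.Iic a ∩ Set.Icc 0 1 = Set.Icc 0 (min a 1) := by
    ext x; simp; tauto
  rw [hset, Real.volume_Icc, sub_zero, ← Set.univ_prod]
  rcases lt_or_ge a 0 with ha | ha
  · have : min a 1 < 0 := by simp [ha]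
    rw [Set.Icc_eq_empty (not_le.2 this), ENNReal.ofReal_of_nonpos this.le]
    simp
  · exact hρ _ ⟨le_min ha zero_le_one, min_le_right _ _⟩

theorem ae_snd_mem_Icc {ρ : ProbabilityMeasure (A × ℝ)} (hρ : ρ ∈ uniformSecondMarginal A) :
    ∀ᵐ p ∂(ρ : Measure (A × ℝ)), p.2 ∈ Set.Icc (0 : ℝ) 1 := by
  have : ∀ᵐ x ∂(ρ : Measure (A × ℝ)).map Prod.snd, x ∈ Set.Icc (0 : ℝ) 1 := by
    rw [snd_eq_volume_restrict hρ]
    exact ae_restrict_mem measurableSet_Icc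
  exact ae_of_ae_map measurable_snd.aemeasurable this

theorem measure_snd_preimage_singleton {ρ : ProbabilityMeasure (A × ℝ)}
    (hρ : ρ ∈ uniformSecondMarginal A) (t : ℝ) :
    (ρ : Measure (A × ℝ)) (Prod.snd ⁻¹' {t}) = 0 := by
  rw [← Measure.map_apply measurable_snd (measurableSet_singleton t), snd_eq_volume_restrict hρ]
  simp

theorem measure_snd_preimage_Iic {ρ : ProbabilityMeasure (A × ℝ)}
    (hρ : ρ ∈ uniformSecondMarginal A) {t : ℝ} (ht : t ∈ Set.Icc (0 : ℝ) 1) :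
    (ρ : Measure (A × ℝ)) (Prod.snd ⁻¹' Set.Iic t) = ENNReal.ofReal t := by
  rw [← Measure.map_apply measurable_snd measurableSet_Iic, snd_eq_volume_restrict hρ,
    Measure.restrict_apply measurableSet_Iic]
  have hset : Set.Iic t ∩ Set.Icc 0 1 = Set.Icc 0 t := by
    ext x; simp; constructor
    · rintro ⟨h1, h2, h3⟩; exact ⟨h2, h1⟩
    · rintro ⟨h1, h2⟩; exact ⟨h2, h1, h2.trans ht.2⟩
  simp [hset]

/-- Two independent samples have distinct second coordinates almost surely. -/
theorem measure_pi_tie {ρ : ProbabilityMeasure (A × ℝ)} (hρ : ρ ∈ uniformSecondMarginal A)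
    {k : ℕ} {i j : Fin k} (hij : i ≠ j) :
    (Measure.pi fun _ : Fin k => (ρ : Measure (A × ℝ))) {z | (z i).2 = (z j).2} = 0 := by
  have hind := (iIndepFun_pi (μ := fun _ : Fin k => (ρ : Measure (A × ℝ)))
    (X := fun _ => Prod.snd) fun _ => measurable_snd.aemeasurable).indepFun hij
  have hm : ∀ l : Fin k, Measurable fun z : Fin k → A × ℝ => (z l).2 :=
    fun l => (measurable_pi_apply l).snd
  rw [indepFun_iff_map_prod_eq_prod_map_map (hm i).aemeasurable (hm j).aemeasurable] at hind
  have hmap : ∀ l : Fin k, Measure.map (fun z : Fin k → A × ℝ => (z l).2)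
      (Measure.pi fun _ : Fin k => (ρ : Measure (A × ℝ))) =
      volume.restrict (Set.Icc (0 : ℝ) 1) := fun l => by
    have := (measurePreserving_eval (fun _ : Fin k => (ρ : Measure (A × ℝ))) l).map_eq
    rw [← snd_eq_volume_restrict hρ, ← this, Measure.map_map measurable_snd (measurable_pi_apply l),
      this]
    rfl
  have hd : MeasurableSet {p : ℝ × ℝ | p.1 = p.2} :=
    measurableSet_eq_fun measurable_fst measurable_snd
  have : {z : Fin k → A × ℝ | (z i).2 = (z j).2} =
      (fun z => ((z i).2, (z j).2)) ⁻¹' {p : ℝ × ℝ | p.1 = p.2} := rfl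
  rw [this, ← Measure.map_apply ((hm i).prodMk (hm j)) hd, hind, hmap i, hmap j,
    Measure.prod_apply hd]
  refine lintegral_eq_zero_of_ae_eq_zero (ae_of_all _ fun x => ?_)
  have : Prod.mk x ⁻¹' {p : ℝ × ℝ | p.1 = p.2} = {x} := by ext y; simp [eq_comm]
  simp [this]

end Marginal

end ErasedWord

namespace ErasedWord

open ProbabilityTheory

section OrderStatistics

/-- The total deviation of the empirical distribution function of `x` from that of the uniform
distribution on `[0, 1]`, over the grid `{m / M | m ≤ M}`. -/
noncomputable def gridError {n : ℕ} (M : ℕ) (x : Fin n → ℝ) : ℝ :=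
  ∑ m ∈ Finset.range (M + 1),
    |(n : ℝ)⁻¹ * ∑ i, (Set.Iic ((m : ℝ) / M)).indicator (fun _ => (1 : ℝ)) (x i) - (m : ℝ) / M|

theorem abs_sort_sub_le_gridError {n M : ℕ} (hM : 0 < M) (x : Fin n → ℝ)
    (hx : ∀ i, x i ∈ Set.Icc (0 : ℝ) 1) (j : Fin n) :
    |x (Tuple.sort x j) - ((j : ℕ) + 1 : ℝ) / n| ≤ gridError M x + 1 / M := by
  classical
  have hn : (0 : ℝ) < n := by exact_mod_cast j.pos
  have hM' : (0 : ℝ) < M := by exact_mod_cast hM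
  set s := x ∘ Tuple.sort x
  have hs : Monotone s := Tuple.monotone_sort x
  have hcard : ∀ t : ℝ, ∑ i, (Set.Iic t).indicator (fun _ => (1 : ℝ)) (x i) =
      (Finset.univ.filter fun i => s i ≤ t).card := fun t => by
    rw [← Equiv.sum_comp (Tuple.sort x)]
    simp [Set.indicator_apply, s]
  have hgrid : ∀ m ≤ M,
      |((Finset.univ.filter fun i => s i ≤ (m : ℝ) / M).card : ℝ) / n - (m : ℝ) / M| ≤
        gridError M x := fun m hm => by
    rw [← hcard, div_eq_inv_mul]
    exact Finset.single_le_sum (f := fun m : ℕ => |(n : ℝ)⁻¹ * ∑ i,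
      (Set.Iic ((m : ℝ) / M)).indicator (fun _ => (1 : ℝ)) (x i) - (m : ℝ) / M|)
      (fun _ _ => abs_nonneg _) (Finset.mem_range.2 (Nat.lt_succ_of_le hm))
  have hs01 : s j ∈ Set.Icc (0 : ℝ) 1 := hx _
  change |s j - _| ≤ _
  set m := ⌈(M : ℝ) * s j⌉₊
  have hm1 : (M : ℝ) * s j ≤ m := Nat.le_ceil _
  have hm2 : (m : ℝ) < M * s j + 1 := Nat.ceil_lt_add_one (mul_nonneg hM'.le hs01.1)
  have hmM : m ≤ M := Nat.ceil_le.2 (by nlinarith [hs01.2])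
  have hupper : s j ≤ (m : ℝ) / M := by rw [le_div_iff₀ hM']; linarith
  have hlower : (m : ℝ) / M ≤ s j + 1 / M := by
    rw [div_le_iff₀ hM', add_mul, one_div_mul_cancel hM'.ne']; linarith
  have hj1 : ((j : ℕ) + 1 : ℝ) ≤ (Finset.univ.filter fun i => s i ≤ (m : ℝ) / M).card := by
    exact_mod_cast (Tuple.lt_card_le_iff_apply_le_of_monotone hs).2 hupper
  rw [abs_le]
  constructor
  · have h1 := (abs_le.1 (hgrid m hmM)).2
    have h2 := div_le_div_of_nonneg_right hj1 hn.le
    linarith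
  · rcases Nat.eq_zero_or_pos m with h0 | hpos
    · have h3 : s j ≤ 0 := by simpa [h0] using hupper
      have h4 : 0 ≤ ((j : ℕ) + 1 : ℝ) / n := by positivity
      have h5 : 0 ≤ gridError M x := Finset.sum_nonneg fun _ _ => abs_nonneg _
      have : (0 : ℝ) ≤ 1 / M := by positivity
      linarith
    · have hcast : ((m - 1 : ℕ) : ℝ) = m - 1 := by
        rw [Nat.cast_sub hpos, Nat.cast_one]
      have h1 := (abs_le.1 (hgrid (m - 1) (by omega))).1
      have h2 : ¬ s j ≤ ((m - 1 : ℕ) : ℝ) / M := by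
        rw [hcast, le_div_iff₀ hM']; linarith
      have h3 := (not_congr (Tuple.lt_card_le_iff_apply_le_of_monotone hs)).2 h2
      have h4 : ((Finset.univ.filter fun i => s i ≤ ((m - 1 : ℕ) : ℝ) / M).card : ℝ) ≤
          (j : ℕ) + 1 := by
        exact_mod_cast (not_lt.1 h3).trans (Nat.le_succ _)
      have h5 := div_le_div_of_nonneg_right h4 hn.le
      have h6 : ((m - 1 : ℕ) : ℝ) / M = m / M - 1 / M := by rw [hcast, sub_div]
      linarith

theorem abs_mean_inducedOrderStat_sub_le {A : Type*} {n M : ℕ} (hM : 0 < M) (z : Fin n → A × ℝ)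
    (hz : ∀ i, (z i).2 ∈ Set.Icc (0 : ℝ) 1) {f : A × ℝ → ℝ} {K : ℝ} (hK : 0 ≤ K)
    (hf : ∀ a x y, |f (a, x) - f (a, y)| ≤ K * |x - y|) :
    |(n : ℝ)⁻¹ * ∑ j, f (inducedOrderStat z j, ((j : ℕ) + 1 : ℝ) / n) -
      (n : ℝ)⁻¹ * ∑ i, f (z i)| ≤ K * (gridError M (fun i => (z i).2) + 1 / M) := by
  have hnn : 0 ≤ gridError M (fun i => (z i).2) + 1 / M :=
    add_nonneg (Finset.sum_nonneg fun _ _ => abs_nonneg _) (by positivity)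
  rcases Nat.eq_zero_or_pos n with h0 | hn
  · subst h0; simpa using mul_nonneg hK hnn
  have hn' : (0 : ℝ) < n := by exact_mod_cast hn
  rw [← Equiv.sum_comp (Tuple.sort fun l => (z l).2) fun i => f (z i), ← mul_sub,
    ← Finset.sum_sub_distrib, abs_mul, abs_of_pos (inv_pos.2 hn'), inv_mul_le_iff₀ hn']
  refine (Finset.abs_sum_le_sum_abs _ _).trans ?_
  refine (Finset.sum_le_card_nsmul _ _ (K * (gridError M (fun i => (z i).2) + 1 / M))
    fun j _ => ?_).trans (by simp)
  refine (hf _ _ _).trans (mul_le_mul_of_nonneg_left ?_ hK)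
  rw [abs_sub_comm]
  exact abs_sort_sub_le_gridError hM (fun l => (z l).2) hz j

end OrderStatistics

section PositionSample

variable {A : Type*} [MeasurableSpace A]

theorem rho_eq_empirical (w : Word A) :
    rho w = empirical (n := w.1) fun j : Fin w.1 => (w.2 j, ((j : ℕ) + 1 : ℝ) / (w.1 : ℕ)) := rfl

theorem integral_positionSample {n : ℕ+} (μ : ProbabilityMeasure (Fin n → A)) {f : A × ℝ → ℝ}
    (hf : StronglyMeasurable f) {b : ℝ} (hb : ∀ p, |f p| ≤ b) :
    ∫ p, f p ∂(positionSample μ : Measure (A × ℝ)) =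
      ∫ v, ((n : ℕ) : ℝ)⁻¹ * ∑ j : Fin n, f (v j, ((j : ℕ) + 1 : ℝ) / (n : ℕ)) ∂(μ : Measure (Fin n → A)) := by
  have hj : ∀ j : Fin n, Measurable fun v : Fin n → A => (v j, ((j : ℕ) + 1 : ℝ) / (n : ℕ)) :=
    fun j => (measurable_pi_apply j).prodMk measurable_const
  have hmeas : (positionSample μ : Measure (A × ℝ)) = ((n : ℕ) : ENNReal)⁻¹ • ∑ j : Fin n,
      (μ : Measure (Fin n → A)).map fun v => (v j, ((j : ℕ) + 1 : ℝ) / (n : ℕ)) := by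
    ext s hs
    change (μ : Measure (Fin n → A)).bind positionMeasure s = _
    have hind : ∀ j : Fin n, Measurable fun v : Fin n → A =>
        s.indicator (1 : A × ℝ → ENNReal) (v j, ((j : ℕ) + 1 : ℝ) / (n : ℕ)) := fun j =>
      (measurable_one.indicator hs).comp (hj j)
    rw [Measure.bind_apply hs (measurable_positionMeasure n).aemeasurable]
    simp only [positionMeasure, Measure.smul_apply, Measure.finsetSum_apply, smul_eq_mul,
      Measure.dirac_apply' _ hs]
    rw [lintegral_const_mul _ (Finset.measurable_sum _ fun j _ => hind j),
      lintegral_finsetSum _ fun j _ => hind j]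
    congr 1
    refine Finset.sum_congr rfl fun j _ => ?_
    rw [Measure.map_apply (hj j) hs, ← lintegral_indicator_one (hj j hs)]
    rfl
  have hint : ∀ j : Fin n, Integrable (fun v : Fin n → A => f (v j, ((j : ℕ) + 1 : ℝ) / (n : ℕ)))
      (μ : Measure (Fin n → A)) := fun j =>
    Integrable.of_bound (hf.comp_measurable (hj j)).aestronglyMeasurable b
      (ae_of_all _ fun v => hb _)
  rw [hmeas, integral_smul_measure, integral_finsetSum_measure, integral_const_mul,
    integral_finsetSum _ fun j _ => hint j]
  · simp only [ENNReal.toReal_inv, ENNReal.toReal_natCast, smul_eq_mul]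
    congr 1
    exact Finset.sum_congr rfl fun j _ =>
      integral_map (hj j).aemeasurable hf.aestronglyMeasurable
  · exact fun j _ => Integrable.of_bound hf.aestronglyMeasurable b (ae_of_all _ hb)

theorem measurable_indicator_snd (t : ℝ) :
    Measurable fun p : A × ℝ => (Set.Iic t).indicator (fun _ => (1 : ℝ)) p.2 :=
  (measurable_const.indicator measurableSet_Iic).comp measurable_snd

theorem integrable_abs_sampleMean_sub {Ω : Type*} [MeasurableSpace Ω] (ρ : Measure Ω)
    [IsProbabilityMeasure ρ] (n : ℕ) {h : Ω → ℝ} (hm : Measurable h) {b : ℝ}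
    (hb : ∀ x, |h x| ≤ b) (c : ℝ) :
    Integrable (fun z : Fin n → Ω => |(n : ℝ)⁻¹ * ∑ i, h (z i) - c|)
      (Measure.pi fun _ : Fin n => ρ) := by
  refine Integrable.abs (Integrable.sub (Integrable.const_mul (integrable_finsetSum _
    fun i _ => ?_) _) (integrable_const c))
  exact Integrable.of_bound (hm.comp (measurable_pi_apply i)).aestronglyMeasurable b
    (ae_of_all _ fun z => hb (z i))

theorem abs_indicator_one_le {α : Type*} (s : Set α) (x : α) :
    |s.indicator (fun _ => (1 : ℝ)) x| ≤ 1 := by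
  by_cases h : x ∈ s <;> simp [h]

theorem integrable_gridError (ρ : Measure (A × ℝ)) [IsProbabilityMeasure ρ] (n M : ℕ) :
    Integrable (fun z : Fin n → A × ℝ => gridError M fun i => (z i).2)
      (Measure.pi fun _ : Fin n => ρ) :=
  integrable_finsetSum _ fun _ _ => integrable_abs_sampleMean_sub ρ n (measurable_indicator_snd _)
    (fun _ => abs_indicator_one_le _ _) _

theorem integral_gridError_le {ρ : ProbabilityMeasure (A × ℝ)} (hρ : ρ ∈ uniformSecondMarginal A)
    (n : ℕ+) (M : ℕ) :
    ∫ z, gridError M (fun i => (z i).2) ∂(Measure.pi fun _ : Fin n => (ρ : Measure (A × ℝ))) ≤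
      (M + 1) / √(n : ℕ) := by
  unfold gridError
  rw [integral_finsetSum _ fun _ _ => integrable_abs_sampleMean_sub _ n
    (measurable_indicator_snd _) (fun _ => abs_indicator_one_le _ _) _]
  refine (Finset.sum_le_card_nsmul _ _ (1 / √(n : ℕ)) fun m hm => ?_).trans (le_of_eq ?_)
  · have hmM : (m : ℝ) ≤ M := by exact_mod_cast Nat.lt_succ_iff.1 (Finset.mem_range.1 hm)
    have ht : (m : ℝ) / M ∈ Set.Icc (0 : ℝ) 1 :=
      ⟨by positivity, div_le_one_of_le₀ hmM (by positivity)⟩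
    have hint : ∫ p, (Set.Iic ((m : ℝ) / M)).indicator (fun _ => (1 : ℝ)) p.2
        ∂(ρ : Measure (A × ℝ)) = (m : ℝ) / M := by
      have : (fun p : A × ℝ => (Set.Iic ((m : ℝ) / M)).indicator (fun _ => (1 : ℝ)) p.2) =
          (Prod.snd ⁻¹' Set.Iic ((m : ℝ) / M)).indicator 1 := by ext p; rfl
      rw [this, integral_indicator_one (measurable_snd measurableSet_Iic), measureReal_def,
        measure_snd_preimage_Iic hρ ht, ENNReal.toReal_ofReal ht.1]
    have := integral_abs_sampleMean_sub_le (ρ : Measure (A × ℝ)) n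
      (measurable_indicator_snd ((m : ℝ) / M)) (fun _ => abs_indicator_one_le _ _)
    rwa [hint] at this
  · simp [div_eq_mul_inv]

theorem ae_pi_snd_mem_Icc {ρ : ProbabilityMeasure (A × ℝ)} (hρ : ρ ∈ uniformSecondMarginal A)
    (n : ℕ) : ∀ᵐ z ∂(Measure.pi fun _ : Fin n => (ρ : Measure (A × ℝ))),
      ∀ i, (z i).2 ∈ Set.Icc (0 : ℝ) 1 :=
  ae_all_iff.2 fun i => (measurePreserving_eval (fun _ : Fin n => (ρ : Measure (A × ℝ))) i
    ).quasiMeasurePreserving.ae (ae_snd_mem_Icc hρ)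

theorem abs_integral_positionSample_spread_sub_le {ρ : ProbabilityMeasure (A × ℝ)}
    (hρ : ρ ∈ uniformSecondMarginal A) (n : ℕ+) {M : ℕ} (hM : 0 < M) {f : A × ℝ → ℝ}
    (hf : StronglyMeasurable f) {b : ℝ} (hb : ∀ p, |f p| ≤ b) {K : ℝ} (hK : 0 ≤ K)
    (hfK : ∀ a x y, |f (a, x) - f (a, y)| ≤ K * |x - y|) :
    |∫ p, f p ∂(positionSample (spread ρ n) : Measure (A × ℝ)) -
      ∫ p, f p ∂(ρ : Measure (A × ℝ))| ≤
      (K * (M + 1) + b) / √(n : ℕ) + K / M := by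
  set P := Measure.pi fun _ : Fin n => (ρ : Measure (A × ℝ))
  set c := ∫ p, f p ∂(ρ : Measure (A × ℝ))
  have hFm : StronglyMeasurable fun v : Fin n → A =>
      ((n : ℕ) : ℝ)⁻¹ * ∑ j : Fin n, f (v j, ((j : ℕ) + 1 : ℝ) / (n : ℕ)) :=
    (Finset.stronglyMeasurable_fun_sum _ fun j _ => hf.comp_measurable
      ((measurable_pi_apply j).prodMk measurable_const)).const_mul _
  have hsp : (spread ρ n : Measure (Fin n → A)) = P.map inducedOrderStat := rfl
  rw [integral_positionSample _ hf hb, hsp,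
    integral_map (measurable_inducedOrderStat n).aemeasurable hFm.aestronglyMeasurable]
  set G : (Fin n → A × ℝ) → ℝ := fun z =>
    ((n : ℕ) : ℝ)⁻¹ * ∑ j : Fin n, f (inducedOrderStat z j, ((j : ℕ) + 1 : ℝ) / (n : ℕ))
  have hGb : ∀ z, |G z| ≤ b := fun z => by
    have hn : (0 : ℝ) < (n : ℕ) := by exact_mod_cast n.pos
    simp only [G]
    rw [abs_mul, abs_of_pos (inv_pos.2 hn), inv_mul_le_iff₀ hn]
    refine (Finset.abs_sum_le_sum_abs _ _).trans ((Finset.sum_le_sum fun j _ => hb _).trans ?_)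
    simp
  have hGint : Integrable G P := Integrable.of_bound
    (hFm.comp_measurable (measurable_inducedOrderStat n)).aestronglyMeasurable b
    (ae_of_all _ hGb)
  have hsub : ∫ z, G z ∂P - c = ∫ z, (G z - c) ∂P := by
    rw [integral_sub hGint (integrable_const c)]; simp
  rw [hsub]
  have hi1 : Integrable (fun z : Fin n → A × ℝ =>
      K * (gridError M (fun i => (z i).2) + 1 / M)) P :=
    ((integrable_gridError _ n M).add (integrable_const _)).const_mul _
  have hi2 := integrable_abs_sampleMean_sub (ρ : Measure (A × ℝ)) n hf.measurable hb c
  have hpt : ∀ᵐ z ∂P, ‖G z - c‖ ≤ K * (gridError M (fun i => (z i).2) + 1 / M) +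
      |((n : ℕ) : ℝ)⁻¹ * ∑ i, f (z i) - c| := by
    filter_upwards [ae_pi_snd_mem_Icc hρ n] with z hz
    rw [Real.norm_eq_abs]
    exact (abs_sub_le _ _ _).trans (add_le_add_left
      (abs_mean_inducedOrderStat_sub_le hM z hz hK hfK) _)
  refine (norm_integral_le_of_norm_le (hi1.add hi2) hpt).trans ?_
  simp only [Pi.add_apply]
  rw [integral_add hi1 hi2, integral_const_mul,
    integral_add (integrable_gridError _ n M) (integrable_const _)]
  have h1 := mul_le_mul_of_nonneg_left (integral_gridError_le hρ n M) hK
  have h2 := integral_abs_sampleMean_sub_le (ρ : Measure (A × ℝ)) n hf.measurable hb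
  simp only [integral_const, probReal_univ, one_smul]
  have h3 : (K * (M + 1) + b) / √(n : ℕ) + K / M =
      K * ((M + 1) / √(n : ℕ)) + K * (1 / M) + b / √(n : ℕ) := by ring
  rw [h3, mul_add]
  exact add_le_add (add_le_add_left h1 _) h2

end PositionSample

end ErasedWord

namespace ErasedWord

open ProbabilityTheory BoundedContinuousFunction

theorem continuousAt_inducedOrderStat {A : Type*} [TopologicalSpace A] {k : ℕ}
    {z : Fin k → A × ℝ}
    (hz : ∀ i j, i ≠ j → (z i).2 ≠ (z j).2) : ContinuousAt inducedOrderStat z := by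
  set σ := Tuple.sort fun l => (z l).2
  have hmono : Monotone ((fun l => (z l).2) ∘ σ) := Tuple.monotone_sort _
  have hopen : ∀ᶠ z' in 𝓝 z, ∀ i j : Fin k, i < j → (z' (σ i)).2 < (z' (σ j)).2 := by
    refine eventually_all.2 fun i => eventually_all.2 fun j => ?_
    by_cases hij : i < j
    · have hc : ∀ l : Fin k, Continuous fun z' : Fin k → A × ℝ => (z' l).2 := fun l =>
        (continuous_apply l).snd
      have := ((hc (σ i)).tendsto z).eventually_lt ((hc (σ j)).tendsto z)
        (lt_of_le_of_ne (hmono hij.le) (hz _ _ (σ.injective.ne hij.ne)))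
      exact this.mono fun _ h _ => h
    · exact Eventually.of_forall fun _ h => absurd h hij
  have heq : (fun z' : Fin k → A × ℝ => fun i => (z' (σ i)).1) =ᶠ[𝓝 z] inducedOrderStat := by
    filter_upwards [hopen] with z' hz'
    have : σ = Tuple.sort fun l => (z' l).2 := by
      refine Tuple.eq_sort_iff.2 ⟨monotone_iff_forall_lt.2 fun i j hij => (hz' i j hij).le,
        fun i j hij he => absurd he (hz' i j hij).ne⟩
    ext i
    simp only [inducedOrderStat, ← this]
  refine ContinuousAt.congr ?_ heq
  exact (continuous_pi fun i => (continuous_apply (σ i)).fst).continuousAt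

theorem tendsto_div_sqrt_pnat (c : ℝ) :
    Tendsto (fun n : ℕ+ => c / √((n : ℕ) : ℝ)) atTop (𝓝 0) := by
  refine Tendsto.const_div_atTop (Real.tendsto_sqrt_atTop.comp
    (tendsto_natCast_atTop_atTop.comp ?_)) c
  exact tendsto_atTop_atTop.2 fun b => ⟨⟨b + 1, b.succ_pos⟩, fun a ha =>
    (Nat.le_succ b).trans (PNat.coe_le_coe _ _ |>.2 ha)⟩

theorem exists_sum_abs_empirical_sub_le {A : Type*} [TopologicalSpace A] [MeasurableSpace A]
    [BorelSpace A] {ρ : ProbabilityMeasure (A × ℝ)}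
    (hρ : ρ ∈ uniformSecondMarginal A) (S : Finset (A × ℝ →ᵇ ℝ)) (N : ℕ) {ε : ℝ} (hε : 0 < ε) :
    ∃ n : ℕ+, N ≤ n ∧ ∃ z : Fin n → A × ℝ, (∀ i, (z i).2 ∈ Set.Icc (0 : ℝ) 1) ∧
      ∑ f ∈ S, |∫ p, f p ∂(empirical z : Measure (A × ℝ)) - ∫ p, f p ∂(ρ : Measure (A × ℝ))| ≤
        ε := by
  obtain ⟨n₀, hn₀⟩ := eventually_atTop.1
    ((tendsto_div_sqrt_pnat (∑ f ∈ S, ‖f‖)).eventually_le_const hε)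
  set n : ℕ+ := max n₀ ⟨N + 1, N.succ_pos⟩
  have hb : ∀ (f : A × ℝ →ᵇ ℝ) p, |f p| ≤ ‖f‖ := fun f p => f.norm_coe_le_norm p
  have hi : ∀ f ∈ S, _ := fun f _ => integrable_abs_sampleMean_sub (ρ : Measure (A × ℝ)) n
    f.continuous.measurable (hb f) (∫ p, f p ∂(ρ : Measure (A × ℝ)))
  obtain ⟨z, hz, hle⟩ := exists_notMem_null_le_integral (integrable_finsetSum S hi)
    (ae_iff.1 (ae_pi_snd_mem_Icc hρ n))
  refine ⟨n, ?_, z, by simpa using hz, ?_⟩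
  · have : (⟨N + 1, N.succ_pos⟩ : ℕ+) ≤ n := le_max_right _ _
    exact (Nat.le_succ N).trans (PNat.coe_le_coe _ _ |>.2 this)
  · simp only [integral_empirical z (BoundedContinuousFunction.continuous _).stronglyMeasurable]
    refine hle.trans ?_
    rw [integral_finsetSum S hi]
    refine (Finset.sum_le_sum fun f _ => integral_abs_sampleMean_sub_le (ρ : Measure (A × ℝ)) n
      f.continuous.measurable (hb f)).trans ?_
    rw [← Finset.sum_div]
    exact hn₀ n (le_max_left _ _)

theorem exists_empirical_mem_of_mem_nhds {A : Type*} [TopologicalSpace A] [MeasurableSpace A]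
    [BorelSpace A] {ρ : ProbabilityMeasure (A × ℝ)}
    (hρ : ρ ∈ uniformSecondMarginal A) {U : Set (ProbabilityMeasure (A × ℝ))} (hU : U ∈ 𝓝 ρ)
    (N : ℕ) :
    ∃ n : ℕ+, N ≤ n ∧ ∃ z : Fin n → A × ℝ, (∀ i, (z i).2 ∈ Set.Icc (0 : ℝ) 1) ∧
      empirical z ∈ U := by
  classical
  choose n hn z hz hle using fun q : Finset (A × ℝ →ᵇ ℝ) × ℕ =>
    exists_sum_abs_empirical_sub_le hρ q.1 q.2 (Nat.one_div_pos_of_nat (α := ℝ) (n := q.2))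
  have ht : Tendsto (fun q => empirical (z q)) atTop (𝓝 ρ) := by
    refine ProbabilityMeasure.tendsto_iff_forall_integral_tendsto.2 fun f => ?_
    rw [tendsto_iff_dist_tendsto_zero]
    have h0 : Tendsto (fun q : Finset (A × ℝ →ᵇ ℝ) × ℕ => 1 / ((q.2 : ℝ) + 1)) atTop (𝓝 0) := by
      rw [← prod_atTop_atTop_eq]
      exact tendsto_one_div_add_atTop_nhds_zero_nat.comp tendsto_snd
    refine squeeze_zero' (Eventually.of_forall fun _ => dist_nonneg) ?_ h0
    filter_upwards [eventually_ge_atTop (({f}, 0) : Finset (A × ℝ →ᵇ ℝ) × ℕ)] with q hq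
    rw [Real.dist_eq]
    refine le_trans ?_ (hle q)
    exact Finset.single_le_sum (f := fun f : A × ℝ →ᵇ ℝ =>
      |∫ p, f p ∂(empirical (z q) : Measure (A × ℝ)) - ∫ p, f p ∂(ρ : Measure (A × ℝ))|)
      (fun _ _ => abs_nonneg _) (Finset.singleton_subset_iff.1 hq.1)
  obtain ⟨q, hqU, hqN⟩ := ((ht.eventually hU).and
    (eventually_ge_atTop ((∅, N) : Finset (A × ℝ →ᵇ ℝ) × ℕ))).exists
  exact ⟨n q, hqN.2.trans (hn q), z q, hz q, hqU⟩

variable {A : Type*} [TopologicalSpace A] [PolishSpace A] [MeasurableSpace A] [BorelSpace A]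

/-- Weak convergence on `A × ℝ` can be tested with bounded continuous functions that are Lipschitz
in the second variable. -/
theorem tendsto_of_forall_lipschitz_snd {ι : Type*} {l : Filter ι} [l.IsCountablyGenerated]
    {ν : ι → ProbabilityMeasure (A × ℝ)} {ρ : ProbabilityMeasure (A × ℝ)}
    (h : ∀ f : A × ℝ → ℝ, Continuous f → ∀ b : ℝ, (∀ p, |f p| ≤ b) → ∀ K : ℝ, 0 ≤ K →
      (∀ a x y, |f (a, x) - f (a, y)| ≤ K * |x - y|) →
      Tendsto (fun i => ∫ p, f p ∂(ν i : Measure (A × ℝ))) l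
        (𝓝 (∫ p, f p ∂(ρ : Measure (A × ℝ))))) :
    Tendsto ν l (𝓝 ρ) := by
  let := TopologicalSpace.upgradeIsCompletelyMetrizable A
  refine tendsto_iff_forall_lipschitz_integral_tendsto.2 fun f ⟨C, hC⟩ ⟨K, hK⟩ => ?_
  obtain ⟨p₀⟩ : Nonempty (A × ℝ) := ρ.nonempty
  refine h f hK.continuous (|f p₀| + C) (fun p => ?_) K K.coe_nonneg fun a x y => ?_
  · have h1 := hC p p₀
    rw [Real.dist_eq] at h1
    have h2 := abs_sub_abs_le_abs_sub (f p) (f p₀)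
    linarith
  · have := hK.dist_le_mul (a, x) (a, y)
    rwa [Real.dist_eq, dist_prod_same_left, Real.dist_eq] at this

theorem tendsto_positionSample_spread {ρ : ProbabilityMeasure (A × ℝ)}
    (hρ : ρ ∈ uniformSecondMarginal A) :
    Tendsto (fun k : ℕ+ => positionSample (spread ρ k)) atTop (𝓝 ρ) := by
  refine tendsto_of_forall_lipschitz_snd fun f hf b hb K hK hfK => ?_
  rw [Metric.tendsto_atTop']
  intro ε hε
  obtain ⟨M, hM⟩ := exists_nat_gt (K / (ε / 2))
  have hM0 : (0 : ℝ) < M := (div_nonneg hK (half_pos hε).le).trans_lt hM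
  have hKM : K / M < ε / 2 := by rwa [div_lt_comm₀ hM0 (half_pos hε)]
  obtain ⟨N, hN⟩ := eventually_atTop.1
    ((tendsto_div_sqrt_pnat (K * (M + 1) + b)).eventually_lt_const (half_pos hε))
  refine ⟨N, fun n hn => ?_⟩
  rw [Real.dist_eq]
  refine (abs_integral_positionSample_spread_sub_le hρ n (by exact_mod_cast hM0)
    hf.stronglyMeasurable hb hK hfK).trans_lt ?_
  linarith [hN n hn.le]

section Approximation

theorem tendsto_gridError_of_tendsto_empirical {ρ : ProbabilityMeasure (A × ℝ)}
    (hρ : ρ ∈ uniformSecondMarginal A) {n : ℕ → ℕ+} {z : ∀ m, Fin (n m) → A × ℝ}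
    (h : Tendsto (fun m => empirical (z m)) atTop (𝓝 ρ)) (M : ℕ) :
    Tendsto (fun m => gridError M fun i => (z m i).2) atTop (𝓝 0) := by
  classical
  unfold gridError
  rw [← Finset.sum_const_zero (s := Finset.range (M + 1))]
  refine tendsto_finsetSum _ fun j hj => ?_
  have hjM : (j : ℝ) ≤ M := by exact_mod_cast Nat.lt_succ_iff.1 (Finset.mem_range.1 hj)
  have ht : (j : ℝ) / M ∈ Set.Icc (0 : ℝ) 1 :=
    ⟨by positivity, div_le_one_of_le₀ hjM (by positivity)⟩
  set t := (j : ℝ) / M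
  have hms : MeasurableSet (Prod.snd ⁻¹' Set.Iic t : Set (A × ℝ)) :=
    measurable_snd measurableSet_Iic
  have hfr : (ρ : Measure (A × ℝ)) (frontier (Prod.snd ⁻¹' Set.Iic t)) = 0 := by
    rw [← Set.univ_prod, frontier_univ_prod_eq, frontier_Iic, Set.univ_prod]
    exact measure_snd_preimage_singleton hρ t
  have h1 := ProbabilityMeasure.tendsto_measure_of_null_frontier_of_tendsto' h hfr
  rw [measure_snd_preimage_Iic hρ ht] at h1
  have h2 := (ENNReal.tendsto_toReal ENNReal.ofReal_ne_top).comp h1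
  rw [ENNReal.toReal_ofReal ht.1] at h2
  have h3 : ∀ m, (((n m : ℕ) : ℝ)⁻¹ * ∑ i, (Set.Iic t).indicator (fun _ => (1 : ℝ)) (z m i).2) =
      ((empirical (z m) : Measure (A × ℝ)) (Prod.snd ⁻¹' Set.Iic t)).toReal := fun m => by
    rw [empirical_apply _ hms]
    simp [Set.indicator_apply]
  simp only [h3]
  rw [← abs_zero, ← sub_self t]
  exact (h2.sub_const t).abs

theorem exists_seq_tendsto_rho {ρ : ProbabilityMeasure (A × ℝ)}
    (hρ : ρ ∈ uniformSecondMarginal A) :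
    ∃ w : ℕ → Word A, Tendsto (fun m => (w m).length) atTop atTop ∧
      Tendsto (fun m => rho (w m)) atTop (𝓝 ρ) := by
  obtain ⟨U, hU⟩ := (𝓝 ρ).exists_antitone_basis
  choose n hn z hz hzU using fun m => exists_empirical_mem_of_mem_nhds hρ (hU.mem m) m
  have hE : Tendsto (fun m => empirical (z m)) atTop (𝓝 ρ) := hU.tendsto hzU
  refine ⟨fun m => ⟨n m, inducedOrderStat (z m)⟩, tendsto_atTop_mono hn tendsto_id, ?_⟩
  refine tendsto_of_forall_lipschitz_snd fun f hf b hb K hK hfK => ?_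
  have hlim : Tendsto (fun m => ∫ p, f p ∂(empirical (z m) : Measure (A × ℝ))) atTop
      (𝓝 (∫ p, f p ∂(ρ : Measure (A × ℝ)))) :=
    ProbabilityMeasure.tendsto_iff_forall_integral_tendsto.1 hE
      (BoundedContinuousFunction.ofNormedAddCommGroup f hf b hb)
  suffices h0 : Tendsto (fun m =>
      ∫ p, f p ∂(rho ⟨n m, inducedOrderStat (z m)⟩ : Measure (A × ℝ)) -
        ∫ p, f p ∂(empirical (z m) : Measure (A × ℝ))) atTop (𝓝 0) by
    simpa using h0.add hlim
  rw [Metric.tendsto_atTop]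
  intro ε hε
  obtain ⟨M, hM⟩ := exists_nat_gt (K / (ε / 2))
  have hM0 : (0 : ℝ) < M := (div_nonneg hK (half_pos hε).le).trans_lt hM
  have hKM : K / M < ε / 2 := by rwa [div_lt_comm₀ hM0 (half_pos hε)]
  have hg := (tendsto_gridError_of_tendsto_empirical hρ hE M).const_mul K
  rw [mul_zero] at hg
  obtain ⟨N, hN⟩ := eventually_atTop.1 (hg.eventually_lt_const (half_pos hε))
  refine ⟨N, fun m hm => ?_⟩
  rw [dist_zero_right, Real.norm_eq_abs, rho_eq_empirical,
    integral_empirical _ hf.stronglyMeasurable, integral_empirical _ hf.stronglyMeasurable]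
  refine (abs_mean_inducedOrderStat_sub_le (by exact_mod_cast hM0) (z m) (hz m) hK hfK).trans_lt ?_
  have := hN m hm
  rw [mul_add, mul_one_div]
  linarith

end Approximation

section Continuity

theorem tendsto_spread {ν : ℕ → ProbabilityMeasure (A × ℝ)} {ρ : ProbabilityMeasure (A × ℝ)}
    (hρ : ρ ∈ uniformSecondMarginal A) (h : Tendsto ν atTop (𝓝 ρ)) (k : ℕ+) :
    Tendsto (fun n => spread (ν n) k) atTop (𝓝 (spread ρ k)) := by
  have hpi : Tendsto (fun n => ProbabilityMeasure.pi fun _ : Fin k => ν n) atTop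
      (𝓝 (ProbabilityMeasure.pi fun _ : Fin k => ρ)) :=
    (ProbabilityMeasure.continuous_pi.tendsto _).comp (tendsto_pi_nhds.2 fun _ => h)
  have hg := measurable_inducedOrderStat (A := A) k
  refine tendsto_of_forall_isClosed_limsup_le' fun F hF => ?_
  have happ : ∀ μ : ProbabilityMeasure (A × ℝ), (spread μ k : Measure (Fin k → A)) F =
      (ProbabilityMeasure.pi fun _ : Fin k => μ : Measure _) (inducedOrderStat ⁻¹' F) :=
    fun μ => Measure.map_apply hg hF.measurableSet
  simp only [happ]
  have hlim := ProbabilityMeasure.limsup_measure_closed_le_of_tendsto hpi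
    (isClosed_closure (s := (inducedOrderStat ⁻¹' F : Set (Fin k → A × ℝ))))
  refine le_trans (limsup_le_limsup (Eventually.of_forall fun n => measure_mono subset_closure))
    (hlim.trans ?_)
  have hsub : closure (inducedOrderStat ⁻¹' F : Set (Fin k → A × ℝ)) ⊆
      inducedOrderStat ⁻¹' F ∪ ⋃ i : Fin k, ⋃ j : Fin k, {z | i ≠ j ∧ (z i).2 = (z j).2} := by
    intro z hz
    by_cases ht : ∀ i j, i ≠ j → (z i).2 ≠ (z j).2
    · left
      exact hF.closure_subset ((continuousAt_inducedOrderStat ht).continuousWithinAt.mem_closure hz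
        (Set.mapsTo_preimage _ _))
    · right
      push Not at ht
      obtain ⟨i, j, hij, he⟩ := ht
      exact Set.mem_iUnion.2 ⟨i, Set.mem_iUnion.2 ⟨j, hij, he⟩⟩
  refine (measure_mono hsub).trans ((measure_union_le _ _).trans ?_)
  have h0 : (ProbabilityMeasure.pi fun _ : Fin k => ρ : Measure (Fin k → A × ℝ))
      (⋃ i : Fin k, ⋃ j : Fin k, {z | i ≠ j ∧ (z i).2 = (z j).2}) = 0 := by
    refine measure_iUnion_null fun i => measure_iUnion_null fun j => ?_
    by_cases hij : i = j
    · simp [hij]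
    · simpa [hij] using measure_pi_tie hρ hij
  rw [h0, add_zero]

end Continuity

end ErasedWord

namespace ErasedWord

open ProbabilityTheory BoundedContinuousFunction

section Resampling

theorem orderEmb_comp_perm_injective (k n : ℕ) :
    Function.Injective fun q : (Fin k ↪o Fin n) × Equiv.Perm (Fin k) => fun i => q.1 (q.2 i) := by
  rintro ⟨j, σ⟩ ⟨j', σ'⟩ h
  have hsort : ∀ (j : Fin k ↪o Fin n) (σ : Equiv.Perm (Fin k)),
      (fun i => j (σ i)) ∘ Tuple.sort (fun i => j (σ i)) = j := fun j σ => by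
    have := Tuple.unique_monotone (f := fun i => j (σ i)) (σ := Tuple.sort fun i => j (σ i))
      (τ := σ⁻¹) (Tuple.monotone_sort _)
      (by simpa [Function.comp_def] using! j.monotone)
    rw [this]
    ext i
    simp
  have hj : j = j' := by
    refine DFunLike.coe_injective ?_
    rw [← hsort j σ, ← hsort j' σ']
    simp only at h
    rw [h]
  subst hj
  simp only [Prod.mk.injEq, true_and]
  ext i
  exact congrArg Fin.val (j.injective (congrFun h i))

theorem inducedOrderStat_orderEmb_comp_perm {A : Type*} {k n : ℕ} {φ : Fin n → A × ℝ}
    (hφ : StrictMono fun i => (φ i).2) (j : Fin k ↪o Fin n) (σ : Equiv.Perm (Fin k)) :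
    inducedOrderStat (fun i => φ (j (σ i))) = fun i => (φ (j i)).1 := by
  have hs : StrictMono fun i => (φ (j i)).2 := hφ.comp j.strictMono
  have : σ⁻¹ = Tuple.sort fun l => (φ (j (σ l))).2 := by
    refine Tuple.eq_sort_iff.2 ⟨by simpa [Function.comp_def] using! hs.monotone,
      fun a b hab he => ?_⟩
    have he' : (φ (j a)).2 = (φ (j b)).2 := by simpa using he
    exact absurd he' (hs hab).ne
  ext i
  simp only [inducedOrderStat, ← this]
  simp

variable {A : Type*} [MeasurableSpace A]

theorem integral_rss {w : Word A} {k : ℕ+} (h : (k : ℕ) ≤ w.length) {g : (Fin k → A) → ℝ}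
    (hg : StronglyMeasurable g) :
    ∫ x, g x ∂(rss w k : Measure (Fin k → A)) =
      ((w.length.choose k : ℕ) : ℝ)⁻¹ * ∑ j : Fin k ↪o Fin w.1, g fun i => w.2 (j i) := by
  have : (rss w k : Measure (Fin k → A)) = rssMeasure w.2 k := if_pos h
  rw [this, rssMeasure, integral_smul_measure, integral_finsetSum_measure]
  · simp only [integral_dirac' g _ hg]
    simp [Word.length]
  · exact fun _ _ => integrable_dirac' hg (by simp)

theorem empirical_eq_map {Ω : Type*} [MeasurableSpace Ω] {n : ℕ+} (z : Fin n → Ω) :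
    (empirical z : Measure Ω) = (empirical (n := n) (id : Fin n → Fin n) : Measure (Fin n)).map z := by
  change ((n : ℕ) : ENNReal)⁻¹ • ∑ j : Fin n, Measure.dirac (z j) =
    (((n : ℕ) : ENNReal)⁻¹ • ∑ j : Fin n, Measure.dirac j).map z
  have hz : Measurable z := measurable_of_finite z
  ext s hs
  rw [Measure.map_apply hz hs]
  simp [Measure.dirac_apply' _ hs, Measure.dirac_apply' _ (hz hs)]
  rfl

theorem integral_spread_rho (w : Word A) (k : ℕ+) {g : (Fin k → A) → ℝ}
    (hg : StronglyMeasurable g) :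
    ∫ x, g x ∂(spread (rho w) k : Measure (Fin k → A)) =
      (((w.length : ℕ) : ℝ) ^ (k : ℕ))⁻¹ * ∑ u : Fin k → Fin w.1,
        g (inducedOrderStat fun i => (w.2 (u i), ((u i : ℕ) + 1 : ℝ) / (w.1 : ℕ))) := by
  set φ : Fin w.1 → A × ℝ := fun j => (w.2 j, ((j : ℕ) + 1 : ℝ) / (w.1 : ℕ))
  set ν : Measure (Fin w.1) := (empirical (n := w.1) (id : Fin w.1 → Fin w.1)).toMeasure
  have hφ : Measurable φ := measurable_of_finite φ
  have hsp : (spread (rho w) k : Measure (Fin k → A)) =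
      (Measure.pi fun _ : Fin k => (rho w : Measure (A × ℝ))).map inducedOrderStat := rfl
  have hpi : (Measure.pi fun _ : Fin k => (rho w : Measure (A × ℝ))) =
      (Measure.pi fun _ : Fin k => ν).map fun u i => φ (u i) := by
    have : IsProbabilityMeasure (ν.map φ) := Measure.isProbabilityMeasure_map hφ.aemeasurable
    rw [Measure.pi_map_pi (fun _ => hφ.aemeasurable), rho_eq_empirical, empirical_eq_map]
  have hm := measurable_inducedOrderStat (A := A) k
  have hφk : Measurable fun (u : Fin k → Fin w.1) i => φ (u i) := measurable_of_finite _
  have hν : ∀ a, ν {a} = ((w.1 : ℕ) : ENNReal)⁻¹ := fun a => by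
    classical
    rw [empirical_apply _ (measurableSet_singleton a)]
    simp [Finset.filter_eq']
  rw [hsp, integral_map hm.aemeasurable hg.aestronglyMeasurable, hpi,
    integral_map hφk.aemeasurable (f := fun x => g (inducedOrderStat x))
      (hg.comp_measurable hm).aestronglyMeasurable,
    integral_fintype Integrable.of_finite, Finset.mul_sum]
  refine Finset.sum_congr rfl fun u _ => ?_
  rw [measureReal_def, Measure.pi_singleton]
  simp only [hν]
  simp [Word.length, φ]

/-- Sampling with and without replacement are close when the word is long. -/
theorem abs_integral_spread_rho_sub_integral_rss_le {w : Word A} {k : ℕ+}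
    (h : (k : ℕ) ≤ w.length) {g : (Fin k → A) → ℝ} (hg : StronglyMeasurable g) {b : ℝ}
    (hb : ∀ x, |g x| ≤ b) :
    |∫ x, g x ∂(spread (rho w) k : Measure (Fin k → A)) -
      ∫ x, g x ∂(rss w k : Measure (Fin k → A))| ≤
      2 * b * (1 - (w.length.descFactorial k : ℝ) / (w.length : ℝ) ^ (k : ℕ)) := by
  classical
  set n := w.length
  have hn : (0 : ℝ) < n := by exact_mod_cast w.1.pos
  have hnk : (0 : ℝ) < (n : ℝ) ^ (k : ℕ) := by positivity
  have hC : (0 : ℝ) < (n.choose k : ℝ) := by exact_mod_cast Nat.choose_pos h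
  rw [integral_rss h hg, integral_spread_rho w k hg]
  set φ : Fin w.1 → A × ℝ := fun j => (w.2 j, ((j : ℕ) + 1 : ℝ) / (w.1 : ℕ))
  have hφ : StrictMono fun i => (φ i).2 := fun i j hij => by
    have : ((i : ℕ) : ℝ) < (j : ℕ) := by exact_mod_cast hij
    exact div_lt_div_of_pos_right (by linarith) hn
  set G : (Fin k → Fin w.1) → ℝ := fun u => g (inducedOrderStat fun i => φ (u i))
  set T := Finset.univ.map ⟨_, orderEmb_comp_perm_injective k w.1⟩
  set R := ∑ j : Fin k ↪o Fin w.1, g fun i => w.2 (j i)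
  have hT : ∑ u ∈ T, G u = ((k : ℕ).factorial : ℝ) * R := by
    rw [Finset.sum_map, ← Finset.univ_product_univ, Finset.sum_product, Finset.mul_sum]
    refine Finset.sum_congr rfl fun j _ => ?_
    simp only [Function.Embedding.coeFn_mk, G, inducedOrderStat_orderEmb_comp_perm hφ]
    simp [φ, Fintype.card_perm]
  have hTcard : (T.card : ℝ) = n.descFactorial k := by
    rw [Finset.card_map, Finset.card_univ, Fintype.card_prod, card_orderEmbFin, Fintype.card_perm,
      Fintype.card_fin, Nat.descFactorial_eq_factorial_mul_choose, mul_comm]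
    rfl
  have hTc : (Tᶜ.card : ℝ) = (n : ℝ) ^ (k : ℕ) - n.descFactorial k := by
    rw [Finset.card_compl, Nat.cast_sub (Finset.card_le_univ T), hTcard]
    simp [n, Word.length]
  have hRb : |R| ≤ n.choose k * b := by
    refine (Finset.abs_sum_le_sum_abs _ _).trans ((Finset.sum_le_sum fun j _ => hb _).trans ?_)
    simp only [Finset.sum_const, Finset.card_univ, card_orderEmbFin, nsmul_eq_mul]
    exact le_rfl
  have hrest : |∑ u ∈ Tᶜ, G u| ≤ ((n : ℝ) ^ (k : ℕ) - n.descFactorial k) * b := by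
    refine (Finset.abs_sum_le_sum_abs _ _).trans ((Finset.sum_le_sum fun j _ => hb _).trans ?_)
    rw [Finset.sum_const, nsmul_eq_mul, hTc]
  have hdesc : (n.descFactorial k : ℝ) = (k : ℕ).factorial * n.choose k := by
    rw [Nat.descFactorial_eq_factorial_mul_choose]; push_cast; rfl
  set d := (n : ℝ) ^ (k : ℕ) - n.descFactorial k
  have hd : 0 ≤ d := by rw [← hTc]; positivity
  have hsplit : ((n : ℝ) ^ (k : ℕ))⁻¹ * ∑ u, G u - (n.choose k : ℝ)⁻¹ * R =
      ((n : ℝ) ^ (k : ℕ))⁻¹ * (∑ u ∈ Tᶜ, G u - d * ((n.choose k : ℝ)⁻¹ * R)) := by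
    rw [← Finset.sum_add_sum_compl T G, hT]
    simp only [d, hdesc]
    field_simp
    ring
  have hRb' : |(n.choose k : ℝ)⁻¹ * R| ≤ b := by
    rwa [abs_mul, abs_of_pos (inv_pos.2 hC), inv_mul_le_iff₀ hC]
  rw [hsplit, abs_mul, abs_of_pos (inv_pos.2 hnk), inv_mul_le_iff₀ hnk]
  refine (abs_sub _ _).trans ((add_le_add hrest (?_ : _ ≤ d * b)).trans (le_of_eq ?_))
  · rw [abs_mul, abs_of_nonneg hd]
    exact mul_le_mul_of_nonneg_left hRb' hd
  · simp only [d]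
    field_simp
    ring

end Resampling

section Comparison

variable {A : Type*} [TopologicalSpace A] [PolishSpace A] [MeasurableSpace A] [BorelSpace A]

theorem tendsto_integral_spread_rho_sub_integral_rss {w : ℕ → Word A}
    (hw : Tendsto (fun n => (w n).length) atTop atTop) (k : ℕ+) (g : (Fin k → A) →ᵇ ℝ) :
    Tendsto (fun n => ∫ x, g x ∂(spread (rho (w n)) k : Measure (Fin k → A)) -
      ∫ x, g x ∂(rss (w n) k : Measure (Fin k → A))) atTop (𝓝 0) := by
  have h1 : Tendsto (fun n : ℕ => (n.descFactorial k : ℝ) / (n : ℝ) ^ (k : ℕ)) atTop (𝓝 1) := by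
    refine (Asymptotics.isEquivalent_iff_tendsto_one ?_).1 (isEquivalent_descFactorial (k : ℕ))
    filter_upwards [eventually_gt_atTop 0] with n hn
    positivity
  have h2 : Tendsto (fun n => 2 * ‖g‖ * (1 - ((w n).length.descFactorial k : ℝ) /
      ((w n).length : ℝ) ^ (k : ℕ))) atTop (𝓝 0) := by
    simpa using ((h1.comp hw).const_sub 1).const_mul (2 * ‖g‖)
  refine squeeze_zero_norm' ?_ h2
  filter_upwards [hw.eventually_ge_atTop (k : ℕ)] with n hn
  exact abs_integral_spread_rho_sub_integral_rss_le hn g.continuous.stronglyMeasurable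
    fun x => g.norm_coe_le_norm x

theorem tendsto_rss_iff_tendsto_spread_rho {w : ℕ → Word A}
    (hw : Tendsto (fun n => (w n).length) atTop atTop) (k : ℕ+)
    (μ : ProbabilityMeasure (Fin k → A)) :
    Tendsto (fun n => rss (w n) k) atTop (𝓝 μ) ↔
      Tendsto (fun n => spread (rho (w n)) k) atTop (𝓝 μ) := by
  simp only [ProbabilityMeasure.tendsto_iff_forall_integral_tendsto]
  refine forall_congr' fun g => ⟨fun h => ?_, fun h => ?_⟩
  · simpa using (tendsto_integral_spread_rho_sub_integral_rss hw k g).add h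
  · simpa using h.sub (tendsto_integral_spread_rho_sub_integral_rss hw k g)

end Comparison

end ErasedWord

namespace ErasedWord

open ProbabilityTheory

section Measurable

variable {A : Type*} [MeasurableSpace A]

theorem map_eval_spread_one (ρ : ProbabilityMeasure (A × ℝ)) :
    (spread ρ 1 : Measure (Fin (1 : ℕ+) → A)).map (fun v => v ⟨0, one_pos⟩) =
      (ρ : Measure (A × ℝ)).fst := by
  have hsp : (spread ρ 1 : Measure (Fin (1 : ℕ+) → A)) =
      (Measure.pi fun _ : Fin (1 : ℕ+) => (ρ : Measure (A × ℝ))).map inducedOrderStat := rfl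
  have he := (measurePreserving_eval
    (fun _ : Fin (1 : ℕ+) => (ρ : Measure (A × ℝ))) ⟨0, one_pos⟩)
  rw [hsp, Measure.map_map (measurable_pi_apply _) (measurable_inducedOrderStat _), Measure.fst]
  have : (fun v : Fin (1 : ℕ+) → A => v ⟨0, one_pos⟩) ∘ inducedOrderStat =
      Prod.fst ∘ Function.eval (⟨0, one_pos⟩ : Fin (1 : ℕ+)) (β := fun _ => A × ℝ) := by
    ext z
    have hsub : Subsingleton (Fin (1 : ℕ+)) := inferInstanceAs (Subsingleton (Fin 1))
    simp only [Function.comp_apply, inducedOrderStat, Function.eval]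
    congr 2
    exact Subsingleton.elim _ _
  rw [this, ← Measure.map_map measurable_fst (measurable_pi_apply _), he.map_eq]

theorem ae_rho_snd_mem_Icc (w : Word A) :
    ∀ᵐ p ∂(rho w : Measure (A × ℝ)), p.2 ∈ Set.Icc (0 : ℝ) 1 := by
  classical
  have hn : (0 : ℝ) < (w.1 : ℕ) := by exact_mod_cast w.1.pos
  have hm : MeasurableSet {p : A × ℝ | ¬ p.2 ∈ Set.Icc (0 : ℝ) 1} :=
    (measurable_snd measurableSet_Icc).compl
  rw [ae_iff, rho_eq_empirical, empirical_apply _ hm]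
  simp only [mul_eq_zero, Nat.cast_eq_zero, Finset.card_eq_zero, Finset.filter_eq_empty_iff]
  refine Or.inr fun j _ => not_not.2 ⟨by positivity, (div_le_one hn).2 ?_⟩
  exact_mod_cast j.2

theorem tendsto_rho_Icc {w : ℕ → Word A} (hw : Tendsto (fun n => (w n).length) atTop atTop)
    {t : ℝ} (ht : t ∈ Set.Icc (0 : ℝ) 1) :
    Tendsto (fun n => (rho (w n) : Measure (A × ℝ)) (Set.univ ×ˢ Set.Icc (0 : ℝ) t)) atTop
      (𝓝 (ENNReal.ofReal t)) := by
  classical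
  have hval : ∀ w : Word A, (rho w : Measure (A × ℝ)) (Set.univ ×ˢ Set.Icc (0 : ℝ) t) =
      ENNReal.ofReal ((⌊t * (w.length : ℝ)⌋₊ : ℝ) / (w.length : ℝ)) := fun w => by
    have hn : (0 : ℝ) < (w.1 : ℕ) := by exact_mod_cast w.1.pos
    have hfl : ⌊t * ((w.1 : ℕ) : ℝ)⌋₊ ≤ (w.1 : ℕ) :=
      Nat.floor_le_of_le (mul_le_of_le_one_left hn.le ht.2)
    rw [rho_eq_empirical, empirical_apply _ (MeasurableSet.univ.prod measurableSet_Icc)]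
    have hfilter : (Finset.univ.filter fun j : Fin w.1 =>
        (w.2 j, ((j : ℕ) + 1 : ℝ) / (w.1 : ℕ)) ∈ Set.univ ×ˢ Set.Icc (0 : ℝ) t) =
        Finset.univ.filter fun j : Fin w.1 => (j : ℕ) < ⌊t * ((w.1 : ℕ) : ℝ)⌋₊ := by
      refine Finset.filter_congr fun j _ => ?_
      have h0 : (0 : ℝ) ≤ ((j : ℕ) + 1 : ℝ) / (w.1 : ℕ) := by positivity
      simp only [Set.mem_prod, Set.mem_univ, true_and, Set.mem_Icc, h0]
      rw [div_le_iff₀ hn, ← Nat.succ_le_iff, Nat.le_floor_iff (mul_nonneg ht.1 hn.le)]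
      push_cast
      rfl
    rw [hfilter, Fin.card_filter_val_lt, min_eq_right hfl]
    simp only [Word.length]
    rw [ENNReal.ofReal_div_of_pos hn, ENNReal.ofReal_natCast, ENNReal.ofReal_natCast,
      ENNReal.div_eq_inv_mul]
  simp only [hval]
  exact (ENNReal.continuous_ofReal.tendsto t).comp
    ((tendsto_nat_floor_mul_div_atTop ht.1).comp (tendsto_natCast_atTop_atTop.comp hw))

end Measurable

variable {A : Type*} [TopologicalSpace A] [PolishSpace A] [MeasurableSpace A] [BorelSpace A]

instance t2Space_probabilityMeasure_pi (k : ℕ) : T2Space (ProbabilityMeasure (Fin k → A)) := by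
  have : HasOuterApproxClosed (Fin k → A) := inferInstance
  infer_instance

theorem mem_uniformSecondMarginal_of_tendsto {ν : ℕ → ProbabilityMeasure (A × ℝ)}
    {ρ : ProbabilityMeasure (A × ℝ)} (h : Tendsto ν atTop (𝓝 ρ))
    (hcdf : ∀ t ∈ Set.Icc (0 : ℝ) 1, Tendsto
      (fun n => (ν n : Measure (A × ℝ)) (Set.univ ×ˢ Set.Icc (0 : ℝ) t)) atTop
        (𝓝 (ENNReal.ofReal t)))
    (hsupp : ∀ n, ∀ᵐ p ∂(ν n : Measure (A × ℝ)), p.2 ∈ Set.Icc (0 : ℝ) 1) :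
    ρ ∈ uniformSecondMarginal A := by
  intro t ht
  refine le_antisymm ?_ ?_
  · refine le_of_forall_gt_imp_ge_of_dense fun c hc => ?_
    rcases eq_or_ne c ⊤ with rfl | hctop
    · exact le_top
    lift c to NNReal using hctop
    have htc : t < c := by
      rw [← ENNReal.ofReal_coe_nnreal, ENNReal.ofReal_lt_ofReal_iff_of_nonneg ht.1] at hc
      exact hc
    rcases le_or_gt (1 : ℝ) c with h1 | h1
    · exact prob_le_one.trans (by exact_mod_cast h1)
    have hopen : IsOpen (Set.univ ×ˢ Set.Ioo (-1 : ℝ) c : Set (A × ℝ)) :=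
      isOpen_univ.prod isOpen_Ioo
    have hc01 : (c : ℝ) ∈ Set.Icc (0 : ℝ) 1 := ⟨c.2, h1.le⟩
    calc (ρ : Measure (A × ℝ)) (Set.univ ×ˢ Set.Icc (0 : ℝ) t)
        ≤ (ρ : Measure (A × ℝ)) (Set.univ ×ˢ Set.Ioo (-1 : ℝ) c) :=
          measure_mono (Set.prod_mono le_rfl fun x hx =>
            ⟨by linarith [hx.1], hx.2.trans_lt htc⟩)
      _ ≤ liminf (fun n => (ν n : Measure (A × ℝ)) (Set.univ ×ˢ Set.Ioo (-1 : ℝ) c)) atTop :=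
          ProbabilityMeasure.le_liminf_measure_open_of_tendsto h hopen
      _ ≤ liminf (fun n => (ν n : Measure (A × ℝ)) (Set.univ ×ˢ Set.Icc (0 : ℝ) c)) atTop := by
          refine liminf_le_liminf (Eventually.of_forall fun n => measure_mono_ae ?_)
          filter_upwards [hsupp n] with p hp hmem
          exact ⟨trivial, hp.1, hmem.2.2.le⟩
      _ = ENNReal.ofReal c := (hcdf c hc01).liminf_eq
      _ = c := ENNReal.ofReal_coe_nnreal
  · rw [← (hcdf t ht).limsup_eq]
    exact ProbabilityMeasure.limsup_measure_closed_le_of_tendsto h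
      (isClosed_univ.prod isClosed_Icc)

theorem eq_of_spread_eq {ρ ρ' : ProbabilityMeasure (A × ℝ)}
    (hρ : ρ ∈ uniformSecondMarginal A) (hρ' : ρ' ∈ uniformSecondMarginal A)
    (h : ∀ k, spread ρ k = spread ρ' k) : ρ = ρ' := by
  have h1 := tendsto_positionSample_spread hρ
  simp only [h] at h1
  exact tendsto_nhds_unique h1 (tendsto_positionSample_spread hρ')

theorem isTightMeasureSet_range_of_tendsto {Ω : Type*} [TopologicalSpace Ω] [PolishSpace Ω]
    [MeasurableSpace Ω] [BorelSpace Ω] {μ : ℕ → ProbabilityMeasure Ω} {μ₀ : ProbabilityMeasure Ω}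
    (h : Tendsto μ atTop (𝓝 μ₀)) :
    IsTightMeasureSet (Set.range fun n => (μ n : Measure Ω)) := by
  let := TopologicalSpace.upgradeIsCompletelyMetrizable Ω
  have hc := h.isCompact_insert_range
  have hcl : IsCompact (closure (Set.range μ)) :=
    hc.of_isClosed_subset isClosed_closure
      (closure_minimal (Set.subset_insert _ _) hc.isClosed)
  refine (isTightMeasureSet_of_isCompact_closure hcl).subset ?_
  rintro _ ⟨n, rfl⟩
  exact ⟨μ n, ⟨n, rfl⟩, rfl⟩

theorem isCompact_closure_range_of_tendsto_spread {ν : ℕ → ProbabilityMeasure (A × ℝ)}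
    (hsupp : ∀ n, ∀ᵐ p ∂(ν n : Measure (A × ℝ)), p.2 ∈ Set.Icc (0 : ℝ) 1)
    {μ : ProbabilityMeasure (Fin (1 : ℕ+) → A)}
    (hμ : Tendsto (fun n => spread (ν n) 1) atTop (𝓝 μ)) :
    IsCompact (closure (Set.range ν)) := by
  refine isCompact_closure_of_isTightMeasureSet (IsTightMeasureSet.prodMk ?_ ?_)
  · refine ((isTightMeasureSet_range_of_tendsto hμ).map
      (f := fun v => v ⟨0, one_pos⟩) (continuous_apply _)).subset ?_
    rintro _ ⟨_, ⟨_, ⟨n, rfl⟩, rfl⟩, rfl⟩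
    exact ⟨_, ⟨n, rfl⟩, map_eval_spread_one (ν n)⟩
  · refine isTightMeasureSet_iff_exists_isCompact_measure_compl_le.2 fun ε _ =>
      ⟨Set.Icc 0 1, isCompact_Icc, ?_⟩
    rintro _ ⟨_, ⟨_, ⟨n, rfl⟩, rfl⟩, rfl⟩
    rw [Measure.snd_apply measurableSet_Icc.compl]
    exact (ae_iff.1 (hsupp n)).le.trans zero_le

/-- A sequence whose second marginals are asymptotically uniform converges as soon as all its
`SPREAD` images do. -/
theorem exists_tendsto_of_tendsto_spread {ν : ℕ → ProbabilityMeasure (A × ℝ)}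
    (hcdf : ∀ t ∈ Set.Icc (0 : ℝ) 1, Tendsto
      (fun n => (ν n : Measure (A × ℝ)) (Set.univ ×ˢ Set.Icc (0 : ℝ) t)) atTop
        (𝓝 (ENNReal.ofReal t)))
    (hsupp : ∀ n, ∀ᵐ p ∂(ν n : Measure (A × ℝ)), p.2 ∈ Set.Icc (0 : ℝ) 1)
    {μ : (k : ℕ+) → ProbabilityMeasure (Fin k → A)}
    (hμ : ∀ k, Tendsto (fun n => spread (ν n) k) atTop (𝓝 (μ k))) :
    ∃ ρ ∈ uniformSecondMarginal A, Tendsto ν atTop (𝓝 ρ) := by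
  have hK := isCompact_closure_range_of_tendsto_spread hsupp (hμ 1)
  have hmem : ∀ n, ν n ∈ closure (Set.range ν) := fun n => subset_closure ⟨n, rfl⟩
  have hcluster : ∀ (φ : ℕ → ℕ), Tendsto φ atTop atTop → ∀ ρ,
      Tendsto (ν ∘ φ) atTop (𝓝 ρ) →
        ρ ∈ uniformSecondMarginal A ∧ ∀ k, spread ρ k = μ k := fun φ hφ ρ hρ => by
    have hC := mem_uniformSecondMarginal_of_tendsto hρ (fun t ht => (hcdf t ht).comp hφ)
      fun n => hsupp (φ n)
    exact ⟨hC, fun k => tendsto_nhds_unique (tendsto_spread hC hρ k) ((hμ k).comp hφ)⟩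
  obtain ⟨ρ, -, φ, hφ, hρ⟩ := hK.tendsto_subseq hmem
  obtain ⟨hC, hsp⟩ := hcluster φ hφ.tendsto_atTop ρ hρ
  refine ⟨ρ, hC, tendsto_of_subseq_tendsto fun ψ hψ => ?_⟩
  obtain ⟨ρ', -, χ, hχ, hρ'⟩ := hK.tendsto_subseq fun n => hmem (ψ n)
  obtain ⟨hC', hsp'⟩ := hcluster (ψ ∘ χ) (hψ.comp hχ.tendsto_atTop) ρ' hρ'
  have : ρ' = ρ := eq_of_spread_eq hC' hC fun k => (hsp' k).trans (hsp k).symm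
  exact ⟨χ, this ▸ hρ'⟩

theorem exists_tendsto_rho_of_RSSConvergesTo {w : ℕ → Word A}
    {μ : (k : ℕ+) → ProbabilityMeasure (Fin k → A)} (h : RSSConvergesTo w μ) :
    ∃ ρ ∈ uniformSecondMarginal A, Tendsto (fun n => rho (w n)) atTop (𝓝 ρ) :=
  exists_tendsto_of_tendsto_spread (fun _ ht => tendsto_rho_Icc h.1 ht)
    (fun n => ae_rho_snd_mem_Icc (w n))
    fun k => (tendsto_rss_iff_tendsto_spread_rho h.1 k (μ k)).1 (h.2 k)

theorem RSSConvergesTo_spread {w : ℕ → Word A}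
    (hw : Tendsto (fun n => (w n).length) atTop atTop) {ρ : ProbabilityMeasure (A × ℝ)}
    (hρ : ρ ∈ uniformSecondMarginal A) (h : Tendsto (fun n => rho (w n)) atTop (𝓝 ρ)) :
    RSSConvergesTo w (spread ρ) :=
  ⟨hw, fun k => (tendsto_rss_iff_tendsto_spread_rho hw k _).2 (tendsto_spread hρ h k)⟩

theorem RSSConvergesTo.eq {w : ℕ → Word A} {μ μ' : (k : ℕ+) → ProbabilityMeasure (Fin k → A)}
    (h : RSSConvergesTo w μ) (h' : RSSConvergesTo w μ') : μ = μ' :=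
  funext fun k => tendsto_nhds_unique (h.2 k) (h'.2 k)

theorem spread_mem_martinBoundary {ρ : ProbabilityMeasure (A × ℝ)}
    (hρ : ρ ∈ uniformSecondMarginal A) : spread ρ ∈ martinBoundary A := by
  obtain ⟨w, hw, h⟩ := exists_seq_tendsto_rho hρ
  exact ⟨w, RSSConvergesTo_spread hw hρ h⟩

theorem exists_eq_spread_of_mem_martinBoundary {μ : (k : ℕ+) → ProbabilityMeasure (Fin k → A)}
    (hμ : μ ∈ martinBoundary A) : ∃ ρ ∈ uniformSecondMarginal A, spread ρ = μ := by
  obtain ⟨w, hw⟩ := hμ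
  obtain ⟨ρ, hρ, h⟩ := exists_tendsto_rho_of_RSSConvergesTo hw
  exact ⟨ρ, hρ, (RSSConvergesTo_spread hw.1 hρ h).eq hw⟩

variable (A) in
/-- `ρ ↦ (SPREAD(ρ, k))_k` as a bijection between `C(A)` and the Martin boundary. -/
noncomputable def spreadEquiv : uniformSecondMarginal A ≃ martinBoundary A :=
  Equiv.ofBijective (fun ρ => ⟨spread ρ.1, spread_mem_martinBoundary ρ.2⟩) <| by
    constructor
    · intro ρ ρ' h
      exact Subtype.ext (eq_of_spread_eq ρ.2 ρ'.2
        fun k => congrFun (congrArg Subtype.val h) k)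
    · rintro ⟨μ, hμ⟩
      obtain ⟨ρ, hρ, h⟩ := exists_eq_spread_of_mem_martinBoundary hμ
      exact ⟨⟨ρ, hρ⟩, Subtype.ext h⟩

theorem coe_spreadEquiv (ρ : uniformSecondMarginal A) :
    (spreadEquiv A ρ : (k : ℕ+) → ProbabilityMeasure (Fin k → A)) = spread ρ.1 := rfl

variable (A) in
/-- `ρ ↦ (SPREAD(ρ, k))_k` as a homeomorphism between `C(A)` and the Martin boundary. -/
noncomputable def spreadHomeomorph : uniformSecondMarginal A ≃ₜ martinBoundary A where
  toEquiv := spreadEquiv A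
  continuous_toFun := by
    refine continuous_iff_seqContinuous.2 fun ν ρ h => tendsto_subtype_rng.2 ?_
    exact tendsto_pi_nhds.2 fun k => tendsto_spread ρ.2 (tendsto_subtype_rng.1 h) k
  continuous_invFun := by
    refine continuous_iff_seqContinuous.2 fun μ μ₀ h => tendsto_subtype_rng.2 ?_
    set ν := fun n => (spreadEquiv A).symm (μ n)
    set ρ := (spreadEquiv A).symm μ₀
    have hν : ∀ n, spread (ν n).1 = μ n := fun n => by
      rw [← coe_spreadEquiv, Equiv.apply_symm_apply]
    have hρ : spread ρ.1 = μ₀ := by rw [← coe_spreadEquiv, Equiv.apply_symm_apply]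
    have hsp : ∀ k, Tendsto (fun n => spread (ν n).1 k) atTop (𝓝 (spread ρ.1 k)) := fun k => by
      simp only [hν, hρ]
      exact tendsto_pi_nhds.1 (tendsto_subtype_rng.1 h) k
    obtain ⟨ρ', hρ', hlim⟩ := exists_tendsto_of_tendsto_spread (ν := fun n => (ν n).1)
      (fun t ht => by simp only [(ν _).2 t ht]; exact tendsto_const_nhds)
      (fun n => ae_snd_mem_Icc (ν n).2) hsp
    have : ρ' = ρ.1 := eq_of_spread_eq hρ' ρ.2
      fun k => tendsto_nhds_unique (tendsto_spread hρ' hlim k) (hsp k)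
    exact this ▸ hlim

end ErasedWord

theorem theorem2 (A : Type*) [TopologicalSpace A] [PolishSpace A] [MeasurableSpace A]
    [BorelSpace A] :
    (∀ w : ℕ → ErasedWord.Word A, Tendsto (fun n => (w n).length) atTop atTop →
      ((∃ μ ∈ ErasedWord.martinBoundary A, ErasedWord.RSSConvergesTo w μ) ↔
        ∃ ρ ∈ ErasedWord.uniformSecondMarginal A,
          Tendsto (fun n => ErasedWord.rho (w n)) atTop (𝓝 ρ)) ∧
      ∀ μ ∈ ErasedWord.martinBoundary A, ∀ ρ ∈ ErasedWord.uniformSecondMarginal A,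
        ErasedWord.RSSConvergesTo w μ →
        Tendsto (fun n => ErasedWord.rho (w n)) atTop (𝓝 ρ) →
          Tendsto (fun k : ℕ+ => ErasedWord.positionSample (μ k)) atTop (𝓝 ρ) ∧
            ∀ k : ℕ+, μ k = ErasedWord.spread ρ k) ∧
    ∃ h : ErasedWord.uniformSecondMarginal A ≃ₜ ErasedWord.martinBoundary A,
      (∀ (ρ : ErasedWord.uniformSecondMarginal A) (k : ℕ+),
        (h ρ).1 k = ErasedWord.spread ρ.1 k) ∧
      ∀ μ : ErasedWord.martinBoundary A,
        Tendsto (fun k : ℕ+ => ErasedWord.positionSample (μ.1 k)) atTop (𝓝 (h.symm μ).1) := by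
  refine ⟨fun w hw => ⟨⟨?_, ?_⟩, ?_⟩, ErasedWord.spreadHomeomorph A, fun _ _ => rfl, fun μ => ?_⟩
  · rintro ⟨μ, -, h⟩
    exact ErasedWord.exists_tendsto_rho_of_RSSConvergesTo h
  · rintro ⟨ρ, hρ, h⟩
    have hspread := ErasedWord.RSSConvergesTo_spread hw hρ h
    exact ⟨_, ⟨w, hspread⟩, hspread⟩
  · intro μ _ ρ hρ hμ h
    obtain rfl := hμ.eq (ErasedWord.RSSConvergesTo_spread hw hρ h)
    exact ⟨ErasedWord.tendsto_positionSample_spread hρ, fun _ => rfl⟩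
  · obtain ⟨ρ, rfl⟩ := (ErasedWord.spreadHomeomorph A).surjective μ
    rw [Homeomorph.symm_apply_apply]
    exact ErasedWord.tendsto_positionSample_spread ρ.2
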